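/- An inverse sequence of groups consists of groups $H_i$ $(i\in\mathbb N)$ and homomorphisms $p_i^j\colon H_j\to H_i$ for $i<j$ with $p_i^j p_j^k=p_i^k$ whenever $i<j<k$. Its inverse limit is the group $$\varprojlim H_i=\Bigl\{(x_i)\in\prod_{i\in\mathbb N}H_i \;\Big|\; p_i^j(x_j)=x_i \text{ for all } i<j\Bigr\},$$ with the coordinate projections $p_i\colon\varprojlim H_i\to H_i$. The sequence satisfies the Mittag-Leffler condition if for every $i$ there is $j>i$ such that $p_i^k(H_k)=p_i^j(H_j)$ for all $k\ge j$. A group $G$ is called inverse limit slender if for every inverse sequence of groups $(H_i,p_i^j)$ satisfying the Mittag-Leffler condition and every homomorphism $\varphi\colon\varprojlim H_i\to G$ there are an index $i$ and a homomorphism $\overline\varphi\colon H_i\to G$ such that $\varphi=\overline\varphi\circ p_i$. Theorem. The class of inverse limit slender groups is closed under subgroups, extensions, arbitrary direct sums and arbitrary free products. That is: 1. Every subgroup of an inverse limit slender group is inverse limit slender. 2. If $1\to A\to E\to Q\to 1$ is a short exact sequence of groups and $A$ and $Q$ are inverse limit slender, then so is $E$. 3. If $(G_\lambda)_{\lambda\in\Lambda}$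 is any family of inverse limit slender groups, then the direct sum $\bigoplus_{\lambda\in\Lambda}G_\lambda$ (the subgroup of $\prod_{\lambda\in\Lambda}G_\lambda$ of elements all but finitely many of whose coordinates are trivial) is inverse limit slender. 4. If $(G_\lambda)_{\lambda\in\Lambda}$ is any family of inverse limit slender groups, then their free product is inverse limit slender. -/

import Mathlib

universe v u

/-- An inverse sequence of groups: groups `obj i` and bonding homomorphisms
`bond : obj j →* obj i` for `i < j`, compatible with composition. -/
structure InverseSequence where
  obj : ℕ → Type v
  [group : ∀ i, Group (obj i)]
  bond : ∀ {i j : ℕ}, i < j → (obj j →* obj i)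
  bond_comp : ∀ {i j k : ℕ} (hij : i < j) (hjk : j < k),
    (bond hij).comp (bond hjk) = bond (hij.trans hjk)

namespace InverseSequence

instance instGroupObj (S : InverseSequence.{v}) (i : ℕ) : Group (S.obj i) := S.group i

/-- The inverse limit: the group of compatible sequences, inside the product of the terms. -/
def limit (S : InverseSequence.{v}) : Subgroup (∀ i, S.obj i) where
  carrier := {x | ∀ ⦃i j : ℕ⦄ (h : i < j), S.bond h (x j) = x i}
  one_mem' := by
    intro i j h
    simp
  mul_mem' := by
    intro x y hx hy i j h
    simp [hx h, hy h]
  inv_mem' := by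
    intro x hx i j h
    simp [hx h]

/-- The projection of the inverse limit to the `i`-th term. -/
def proj (S : InverseSequence.{v}) (i : ℕ) : S.limit →* S.obj i :=
  (Pi.evalMonoidHom S.obj i).comp S.limit.subtype

/-- The Mittag-Leffler condition: for every `i` the images of the bonding maps into the `i`-th
term are eventually constant. -/
def IsMittagLeffler (S : InverseSequence.{v}) : Prop :=
  ∀ i : ℕ, ∃ (j : ℕ) (h : i < j), ∀ (k : ℕ) (hk : j ≤ k),
    (S.bond (h.trans_le hk)).range = (S.bond h).range

end InverseSequence

/-- A group `G` is inverse limit slender if every homomorphism to `G` from the inverse limit of an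
inverse sequence of groups satisfying the Mittag-Leffler condition factors through the projection
to some term of the sequence. -/
def IsInverseLimitSlender (G : Type u) [Group G] : Prop :=
  ∀ S : InverseSequence.{v}, S.IsMittagLeffler → ∀ φ : S.limit →* G,
    ∃ (i : ℕ) (ψ : S.obj i →* G), φ = ψ.comp (S.proj i)

/-- The direct sum of a family of (not necessarily abelian) groups: the subgroup of the product
formed by the elements all but finitely many of whose coordinates are trivial. -/
def groupDirectSum {ι : Type*} (G : ι → Type*) [∀ i, Group (G i)] : Subgroup (∀ i, G i) where
  carrier := {x | {i | x i ≠ 1}.Finite}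
  one_mem' := by simp
  mul_mem' := by
    intro x y hx hy
    refine (Set.Finite.union hx hy).subset ?_
    intro i hi
    by_contra hn
    rw [Set.mem_union, not_or] at hn
    exact hi (by simp [not_not.mp hn.1, not_not.mp hn.2])
  inv_mem' := by
    intro x hx
    simpa using hx

/-! Slenderness of `G` is equivalent to a statement about kernels (`isInverseLimitSlender_iff`):
every homomorphism to `G` from a group complete for a decreasing sequence of normal subgroups `K n`
kills some `K n`. Subgroups are then immediate, and extensions follow because each `K n` is again
completely filtered.

If a homomorphism kills no `K n`, completeness allows infinite products of bad elements. For direct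
sums, a gliding hump produces an element whose image has infinite support.

For free products, map to the direct sum, which is slender. A nontrivial element of the kernel is
not conjugate into a factor, so squaring increases its word length. Solving `y n = x n * y (n + 1) ^
(2 ^ e)` with large `e` would make lengths descend forever (`isInverseLimitSlender_of_length`). So
the kernel is slender, and the extension case applies. -/

namespace InverseSequence

/-! ### Threads and stable images in an inverse sequence -/

variable (S : InverseSequence.{v})

theorem bond_bond {i j k : ℕ} (hij : i < j) (hjk : j < k) (x : S.obj k) :
    S.bond hij (S.bond hjk x) = S.bond (hij.trans hjk) x :=
  DFunLike.congr_fun (S.bond_comp hij hjk) x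

theorem bond_proj {i j : ℕ} (h : i < j) (x : S.limit) :
    S.bond h (S.proj j x) = S.proj i x :=
  x.2 h

/-- A compatible sequence of elements of the terms from the `i`-th on extends to an element of the
limit. -/
theorem exists_proj_eq_of_tail {i : ℕ} (z : ∀ n, S.obj (i + n))
    (hz : ∀ n, S.bond (Nat.lt_succ_self (i + n)) (z (n + 1)) = z n) :
    ∃ x : S.limit, S.proj i x = z 0 := by
  have hz' : ∀ a b (h : a < b), S.bond (Nat.add_lt_add_left h i) (z b) = z a := by
    intro a b h
    induction b, h using Nat.le_induction with
    | base => exact hz a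
    | succ b hb ih => rw [← ih, ← hz b, bond_bond]
  -- Bonds exist only for strict inequalities; the shift to `i + (m + 1)` provides one for every
  -- `m`, even when `i = 0`.
  refine ⟨⟨fun m => S.bond (show m < i + (m + 1) by lia) (z (m + 1)), ?_⟩, hz' 0 (i + 1) (by lia)⟩
  intro a b h
  dsimp only
  rw [bond_bond, ← hz' (a + 1) (b + 1) (by lia), bond_bond]

/-- Under the Mittag-Leffler condition, the limit surjects onto the stable images. -/
theorem IsMittagLeffler.exists_range_bond_eq {S : InverseSequence.{v}} (hS : S.IsMittagLeffler)
    (i : ℕ) : ∃ (j : ℕ) (h : i < j), (S.bond h).range = (S.proj i).range := by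
  choose s hs hstable using hS
  -- Stable images surject onto one another: lift `t` to a level past both `s n` and `s (n + 1)`,
  -- then push it down to level `n + 1`.
  have hsurj : ∀ n (t : (S.bond (hs n)).range),
      ∃ u : (S.bond (hs (n + 1))).range, S.bond (Nat.lt_succ_self n) u.1 = t.1 := by
    intro n t
    obtain ⟨y, hy⟩ : t.1 ∈ (S.bond ((hs n).trans_le (le_max_left _ (s (n + 1))))).range := by
      rw [hstable n _ (le_max_left _ _)]
      exact t.2
    have hmax := (hs (n + 1)).trans_le (le_max_right (s n) (s (n + 1)))
    refine ⟨⟨S.bond hmax y, ?_⟩, ?_⟩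
    · rw [← hstable (n + 1) _ (le_max_right (s n) _)]
      exact ⟨y, rfl⟩
    · rw [← hy, bond_bond]
  choose f hf using hsurj
  refine ⟨s i, hs i, le_antisymm ?_ ?_⟩
  · intro t ht
    let z : ∀ n, (S.bond (hs (i + n))).range := fun n => Nat.rec ⟨t, ht⟩ (fun n u => f (i + n) u) n
    obtain ⟨x, hx⟩ := S.exists_proj_eq_of_tail (fun n => (z n).1) fun n => hf (i + n) (z n)
    exact ⟨x, hx⟩
  · rintro _ ⟨x, rfl⟩
    exact ⟨S.proj (s i) x, S.bond_proj _ x⟩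

end InverseSequence

/-! ### Complete filtrations and the kernel form of slenderness -/

/-- A decreasing sequence of normal subgroups of `L` that defines a Hausdorff and complete group
topology; equivalently, `L` is the inverse limit of the quotients `L ⧸ K n`. -/
structure IsCompleteFiltration {L : Type*} [Group L] (K : ℕ → Subgroup L) : Prop where
  normal : ∀ n, (K n).Normal
  antitone : Antitone K
  hausdorff : ∀ x, (∀ n, x ∈ K n) → x = 1
  complete : ∀ x : ℕ → L, (∀ n, (x n)⁻¹ * x (n + 1) ∈ K n) → ∃ y, ∀ n, (x n)⁻¹ * y ∈ K n

namespace InverseSequence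

theorem isCompleteFiltration_ker_proj (S : InverseSequence.{v}) :
    IsCompleteFiltration fun n => (S.proj n).ker where
  normal n := inferInstance
  antitone := by
    apply antitone_nat_of_succ_le
    intro n x hx
    rw [MonoidHom.mem_ker] at hx ⊢
    rw [← S.bond_proj (Nat.lt_succ_self n), hx, map_one]
  hausdorff x hx := Subtype.ext (funext hx)
  complete x hx := by
    have hx' : ∀ n, S.proj n (x (n + 1)) = S.proj n (x n) := by
      intro n
      have := hx n
      rw [MonoidHom.mem_ker, map_mul, map_inv, inv_mul_eq_one] at this
      exact this.symm
    refine ⟨⟨fun n => S.proj n (x n), ?_⟩, ?_⟩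
    · intro i j h
      induction j, h using Nat.le_induction with
      | base => rw [bond_proj, hx']
      | succ j hj ih =>
        dsimp only at ih ⊢
        rw [← ih, ← hx' j, bond_proj, bond_proj]
    · intro n
      rw [MonoidHom.mem_ker, map_mul, map_inv, inv_mul_eq_one]
      rfl

/-- The inverse sequence of quotients by a decreasing sequence of normal subgroups. -/
def ofQuotients {L : Type v} [Group L] (K : ℕ → Subgroup L) [∀ n, (K n).Normal]
    (hK : Antitone K) : InverseSequence.{v} where
  obj n := L ⧸ K n
  bond h := QuotientGroup.map _ _ (MonoidHom.id L) (hK h.le)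
  bond_comp hij hjk := by
    ext x
    rfl

theorem ofQuotients_isMittagLeffler {L : Type v} [Group L] (K : ℕ → Subgroup L)
    [∀ n, (K n).Normal] (hK : Antitone K) : (ofQuotients K hK).IsMittagLeffler := by
  have hsurj : ∀ {i j : ℕ} (h : i < j), ((ofQuotients K hK).bond h).range = ⊤ := by
    intro i j h
    rw [MonoidHom.range_eq_top]
    intro x
    obtain ⟨x, rfl⟩ := QuotientGroup.mk_surjective x
    exact ⟨(x : L ⧸ K j), rfl⟩
  exact fun i => ⟨i + 1, i.lt_succ_self, fun k hk => by rw [hsurj, hsurj]⟩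

/-- The canonical homomorphism to the inverse limit of the quotients. -/
def toLimitOfQuotients {L : Type v} [Group L] (K : ℕ → Subgroup L) [∀ n, (K n).Normal]
    (hK : Antitone K) : L →* (ofQuotients K hK).limit where
  toFun x := ⟨fun n => (x : L ⧸ K n), fun _ _ _ => rfl⟩
  map_one' := rfl
  map_mul' _ _ := rfl

theorem toLimitOfQuotients_bijective {L : Type v} [Group L] {K : ℕ → Subgroup L}
    [∀ n, (K n).Normal] (hK : IsCompleteFiltration K) :
    Function.Bijective (toLimitOfQuotients K hK.antitone) := by
  constructor
  · rw [injective_iff_map_eq_one]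
    intro x hx
    refine hK.hausdorff x fun n => (QuotientGroup.eq_one_iff x).mp ?_
    exact congrFun (congrArg Subtype.val hx) n
  · rintro ⟨z, hz⟩
    choose x hx using fun n => QuotientGroup.mk_surjective (s := K n) (z n)
    obtain ⟨y, hy⟩ := hK.complete x fun n => by
      rw [← QuotientGroup.eq, hx n, ← hz n.lt_succ_self, ← hx (n + 1)]
      rfl
    refine ⟨y, Subtype.ext (funext fun n => ?_)⟩
    exact (QuotientGroup.eq.mpr (hy n)).symm.trans (hx n)

end InverseSequence

/-- A group is inverse limit slender iff every homomorphism to it from a group with a complete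
filtration is trivial on some term of the filtration. -/
theorem isInverseLimitSlender_iff {G : Type u} [Group G] :
    IsInverseLimitSlender.{v} G ↔ ∀ (L : Type v) [Group L] (K : ℕ → Subgroup L),
      IsCompleteFiltration K → ∀ φ : L →* G, ∃ n, K n ≤ φ.ker := by
  constructor
  · intro hG L _ K hK φ
    have := hK.normal
    let e := MulEquiv.ofBijective _ (InverseSequence.toLimitOfQuotients_bijective hK)
    obtain ⟨n, ψ, hψ⟩ := hG _ (InverseSequence.ofQuotients_isMittagLeffler K hK.antitone)
      (φ.comp e.symm.toMonoidHom)
    refine ⟨n, fun x hx => ?_⟩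
    have h1 : φ x = ψ ((x : L ⧸ K n)) := by
      have := DFunLike.congr_fun hψ (e x)
      rw [MonoidHom.comp_apply, MulEquiv.toMonoidHom_eq_coe, MonoidHom.coe_coe,
        e.symm_apply_apply] at this
      exact this
    rw [MonoidHom.mem_ker, h1, (QuotientGroup.eq_one_iff x).mpr hx]
    exact map_one ψ
  · intro h S hS φ
    obtain ⟨i, hi⟩ := h _ _ S.isCompleteFiltration_ker_proj φ
    -- `φ` descends only to the image of `proj i`; by Mittag-Leffler this is the image of some `obj
    -- j`, so the factorization is through `j` rather than `i`.
    obtain ⟨j, hij, hrange⟩ := hS.exists_range_bond_eq i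
    have hker : (S.proj i).rangeRestrict.ker ≤ φ.ker := by
      rw [MonoidHom.ker_rangeRestrict]
      exact hi
    let ψ := (S.proj i).rangeRestrict.liftOfSurjective (S.proj i).rangeRestrict_surjective
      ⟨φ, hker⟩
    refine ⟨j, ψ.comp ((S.bond hij).codRestrict _ fun x => hrange ▸ ⟨x, rfl⟩), ?_⟩
    ext x
    have h1 : (S.bond hij).codRestrict (S.proj i).range (fun x => hrange ▸ ⟨x, rfl⟩) (S.proj j x) =
        (S.proj i).rangeRestrict x :=
      Subtype.ext (S.bond_proj hij x)
    simp only [MonoidHom.comp_apply]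
    rw [h1]
    exact ((S.proj i).rangeRestrict.liftOfRightInverse_comp_apply _ _ ⟨φ, hker⟩ x).symm

/-! ### Subfiltrations and infinite nested products -/

namespace IsCompleteFiltration

variable {L : Type*} [Group L] {K : ℕ → Subgroup L}

theorem inv_mul_mem_of_le (hK : Antitone K) {x : ℕ → L}
    (hx : ∀ n, (x n)⁻¹ * x (n + 1) ∈ K n) {m n : ℕ} (h : m ≤ n) : (x m)⁻¹ * x n ∈ K m := by
  induction n, h using Nat.le_induction with
  | base => simp
  | succ n hn ih =>
    have := (K m).mul_mem ih (hK hn (hx n))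
    rwa [mul_assoc, mul_inv_cancel_left] at this

theorem comp_strictMono (hK : IsCompleteFiltration K) {f : ℕ → ℕ} (hf : StrictMono f) :
    IsCompleteFiltration (K ∘ f) where
  normal n := hK.normal (f n)
  antitone := hK.antitone.comp_monotone hf.monotone
  hausdorff x hx := hK.hausdorff x fun n => hK.antitone (hf.le_apply (x := n)) (hx n)
  complete x hx := by
    obtain ⟨y, hy⟩ := hK.complete x fun n => hK.antitone (hf.le_apply (x := n)) (hx n)
    refine ⟨y, fun n => ?_⟩
    -- The limit `y` is only known to agree with `x n` modulo `K n`; passing through the later term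
    -- `x (f n)` improves this to `K (f n)`.
    have := (K (f n)).mul_mem
      (inv_mul_mem_of_le (hK.antitone.comp_monotone hf.monotone) hx (hf.le_apply (x := n)))
      (hy (f n))
    rwa [mul_assoc, mul_inv_cancel_left] at this

theorem subgroupOf (hK : IsCompleteFiltration K) (n : ℕ) :
    IsCompleteFiltration fun m => (K (n + m)).subgroupOf (K n) where
  normal m := (hK.normal (n + m)).subgroupOf _
  antitone a b h x hx := hK.antitone (Nat.add_le_add_left h n) hx
  hausdorff x hx := Subtype.ext <| hK.hausdorff x fun m =>
    hK.antitone (Nat.le_add_left m n) (hx m)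
  complete x hx := by
    -- Delaying the sequence by `n` steps matches the filtration indices; truncated subtraction
    -- makes it constant at first.
    obtain ⟨y, hy⟩ := hK.complete (fun m => (x (m - n) : L)) fun m => by
      rcases lt_or_ge m n with h | h
      · rw [Nat.sub_eq_zero_of_le h.le, Nat.sub_eq_zero_of_le h, inv_mul_cancel]
        exact one_mem _
      · have := hx (m - n)
        rw [Subgroup.mem_subgroupOf, Nat.add_sub_cancel' h] at this
        rw [Nat.sub_add_comm h]
        exact this
    have hy' : ∀ m, (x m : L)⁻¹ * y ∈ K (n + m) := by
      intro m
      simpa using hy (n + m)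
    have hyn : y ∈ K n := ((K n).mul_mem_cancel_left ((K n).inv_mem (x 0).2)).mp (hy' 0)
    exact ⟨⟨y, hyn⟩, hy'⟩

/-- In a complete filtered group, infinite nested expressions `x₀ (x₁ (x₂ ⋯)^(m 1))^(m 0)` with
`x n ∈ K n` converge. -/
theorem exists_eq_mul_pow (hK : IsCompleteFiltration K) (x : ℕ → L) (hx : ∀ n, x n ∈ K n)
    (m : ℕ → ℕ) : ∃ y : ℕ → L, (∀ n, y n ∈ K n) ∧ ∀ n, y n = x n * y (n + 1) ^ m n := by
  have := hK.normal
  -- `t r n` is the nested expression starting at `x n`, cut off after `r` levels with `1`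
  -- innermost. The next cutoff changes it only modulo `K (n + r)`.
  let t : ℕ → ℕ → L := fun r =>
    Nat.rec (fun _ => 1) (fun _ f n => x n * f (n + 1) ^ m n) r
  have ht0 : ∀ n, t 0 n = 1 := fun n => rfl
  have ht : ∀ r n, t (r + 1) n = x n * t r (n + 1) ^ m n := fun r n => rfl
  have hmem : ∀ r n, t r n ∈ K n := by
    intro r
    induction r with
    | zero => exact fun n => one_mem _
    | succ r ih =>
      exact fun n => mul_mem (hx n) (pow_mem (hK.antitone n.le_succ (ih (n + 1))) _)
  have hstep : ∀ r n, (QuotientGroup.mk (t r n) : L ⧸ K (n + r)) = QuotientGroup.mk (t (r + 1) n) := by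
    intro r
    induction r with
    | zero =>
      intro n
      rw [QuotientGroup.eq, ht0, inv_one, one_mul]
      exact hmem 1 n
    | succ r ih =>
      intro n
      have := ih (n + 1)
      rw [show n + 1 + r = n + (r + 1) by lia] at this
      rw [ht r, ht (r + 1), QuotientGroup.mk_mul, QuotientGroup.mk_mul, QuotientGroup.mk_pow,
        QuotientGroup.mk_pow, this]
  have hlim : ∀ n, ∃ y, ∀ r, (t r n)⁻¹ * y ∈ K r := fun n =>
    hK.complete (fun r => t r n) fun r =>
      hK.antitone (Nat.le_add_left r n) (QuotientGroup.eq.mp (hstep r n))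
  choose y hy using hlim
  refine ⟨y, fun n => ((K n).mul_mem_cancel_left ((K n).inv_mem (hmem n n))).mp (hy n n), ?_⟩
  intro n
  rw [← inv_mul_eq_one]
  refine hK.hausdorff _ fun r => ?_
  have h1 : (QuotientGroup.mk (t (r + 1) n) : L ⧸ K r) = QuotientGroup.mk (y n) :=
    QuotientGroup.eq.mpr (hK.antitone r.le_succ (hy n (r + 1)))
  have h2 : (QuotientGroup.mk (t r (n + 1)) : L ⧸ K r) = QuotientGroup.mk (y (n + 1)) := QuotientGroup.eq.mpr (hy (n + 1) r)
  rw [← QuotientGroup.eq, QuotientGroup.mk_mul, QuotientGroup.mk_pow, ← h1, ← h2, ht,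
    QuotientGroup.mk_mul, QuotientGroup.mk_pow]

end IsCompleteFiltration

/-! ### Subgroups, extensions and direct sums -/

theorem IsInverseLimitSlender.of_injective {G H : Type*} [Group G] [Group H]
    (hG : IsInverseLimitSlender.{v} G) (f : H →* G) (hf : Function.Injective f) :
    IsInverseLimitSlender.{v} H := by
  rw [isInverseLimitSlender_iff] at hG ⊢
  intro L _ K hK φ
  obtain ⟨n, hn⟩ := hG L K hK (f.comp φ)
  refine ⟨n, fun x hx => hf ?_⟩
  rw [map_one]
  exact hn hx

/-- Once the composite to `Q` kills `K n`, the homomorphism sends `K n` into `f.ker`, and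
slenderness of `f.ker` applies to the filtration induced on `K n`. -/
theorem IsInverseLimitSlender.of_ker {E Q : Type*} [Group E] [Group Q]
    (hQ : IsInverseLimitSlender.{v} Q) (f : E →* Q) (hf : IsInverseLimitSlender.{v} f.ker) :
    IsInverseLimitSlender.{v} E := by
  rw [isInverseLimitSlender_iff] at hQ hf ⊢
  intro L _ K hK φ
  obtain ⟨n, hn⟩ := hQ L K hK (f.comp φ)
  obtain ⟨m, hm⟩ := hf (K n) _ (hK.subgroupOf n)
    ((φ.comp (K n).subtype).codRestrict f.ker fun x => hn x.2)
  refine ⟨n + m, fun x hx => ?_⟩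
  exact congrArg Subtype.val (hm (x := ⟨x, hK.antitone (Nat.le_add_right n m) hx⟩) hx)

theorem IsInverseLimitSlender.of_groupExtension {A E Q : Type*} [Group A] [Group E] [Group Q]
    (S : GroupExtension A E Q) (hA : IsInverseLimitSlender.{v} A)
    (hQ : IsInverseLimitSlender.{v} Q) : IsInverseLimitSlender.{v} E := by
  refine hQ.of_ker S.rightHom ?_
  let e := (MonoidHom.ofInjective S.inl_injective).trans
    (MulEquiv.subgroupCongr S.range_inl_eq_ker_rightHom)
  exact hA.of_injective e.symm.toMonoidHom e.symm.injective

/-- Gliding hump: choose the `x (s k)` so that each later filtration term dies on the support of the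
earlier ones. In the infinite product of the `x (s k)`, only the factor `x (s k)` contributes at
coordinate `i (s k)`, so none of these infinitely many coordinates is trivial. -/
theorem IsInverseLimitSlender.groupDirectSum {ι : Type*} {G : ι → Type*} [∀ i, Group (G i)]
    (hG : ∀ i, IsInverseLimitSlender.{v} (G i)) :
    IsInverseLimitSlender.{v} (groupDirectSum G) := by
  simp only [isInverseLimitSlender_iff] at hG ⊢
  intro L _ K hK φ
  by_contra! hφ
  let c : ∀ i, L →* G i := fun i =>
    (Pi.evalMonoidHom G i).comp ((_root_.groupDirectSum G).subtype.comp φ)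
  have hsupp : ∀ x, {i | c i x ≠ 1}.Finite := fun x => (φ x).2
  have hx : ∀ n, ∃ x ∈ K n, ∃ i, c i x ≠ 1 := by
    intro n
    obtain ⟨x, hxK, hx⟩ := SetLike.not_le_iff_exists.mp (hφ n)
    refine ⟨x, hxK, ?_⟩
    by_contra! h
    exact hx (Subtype.ext (funext h))
  choose x hxK i hxi using hx
  have hg : ∀ n, ∃ m, n < m ∧ ∀ j, c j (x n) ≠ 1 → K m ≤ (c j).ker := by
    intro n
    choose d hd using fun j => hG j L K hK (c j)
    obtain ⟨b, hb⟩ := ((hsupp (x n)).image d).bddAbove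
    -- The support of `x n` is finite, so one bound `b` serves all its coordinates.
    refine ⟨max b n + 1, by lia, fun j hj => (hK.antitone ?_).trans (hd j)⟩
    have := hb ⟨j, hj, rfl⟩
    lia
  choose g hlt hkill using hg
  let s : ℕ → ℕ := fun k => g^[k] 0
  have hs : ∀ k, s (k + 1) = g (s k) := fun k => Function.iterate_succ_apply' g k 0
  have hmono : StrictMono s := strictMono_nat_of_lt_succ fun k => by
    rw [hs]
    exact hlt _
  have hdisj : ∀ {a b : ℕ}, a < b → ∀ {z}, z ∈ K (s b) → ∀ j, c j (x (s a)) ≠ 1 → c j z = 1 := by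
    intro a b hab z hz j hj
    refine hkill (s a) j hj (hK.antitone ?_ hz)
    rw [← hs]
    exact hmono.monotone hab
  obtain ⟨y, hyK, hy⟩ := (hK.comp_strictMono hmono).exists_eq_mul_pow (fun k => x (s k))
    (fun k => hxK (s k)) fun _ => 1
  have hxne : ∀ {a b : ℕ}, a < b → c (i (s b)) (x (s a)) = 1 := by
    intro a b hab
    by_contra h
    exact hxi (s b) (hdisj hab (hxK (s b)) _ h)
  have hinj : Function.Injective fun k => i (s k) := by
    apply Function.Injective.of_lt_imp_ne
    intro a b hab h
    refine hxi (s a) ?_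
    change i (s a) = i (s b) at h
    have := hxne hab
    rwa [← h] at this
  have hyk : ∀ k a, a ≤ k → c (i (s k)) (y 0) = c (i (s k)) (y a) := by
    intro k a
    induction a with
    | zero => exact fun _ => rfl
    | succ a ih =>
      intro ha
      rw [ih (by lia), hy a, pow_one, map_mul, hxne ha, one_mul]
  refine Set.infinite_range_of_injective hinj ((hsupp (y 0)).subset ?_)
  rintro _ ⟨k, rfl⟩
  change c (i (s k)) (y 0) ≠ 1
  rw [hyk k k le_rfl, hy k, pow_one, map_mul,
    hdisj k.lt_succ_self (hyK (k + 1)) _ (hxi (s k)), mul_one]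
  exact hxi (s k)

/-! ### Slenderness from a length function -/

/-- A group with a length function that increases under squaring is inverse limit slender. -/
theorem isInverseLimitSlender_of_length {G : Type*} [Group G] (ℓ : G → ℕ) (h_one : ℓ 1 = 0)
    (h_mul : ∀ a b, ℓ (a * b) ≤ ℓ a + ℓ b) (h_inv : ∀ a, ℓ a⁻¹ ≤ ℓ a)
    (h_sq : ∀ a, a ≠ 1 → ℓ a < ℓ (a ^ 2)) : IsInverseLimitSlender.{v} G := by
  have h_pow : ∀ a, a ≠ 1 → ∀ e, ℓ a + e ≤ ℓ (a ^ 2 ^ e) ∧ a ^ 2 ^ e ≠ 1 := by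
    intro a ha e
    induction e with
    | zero => simpa using ha
    | succ e ih =>
      have := h_sq _ ih.2
      rw [pow_succ 2 e, pow_mul]
      refine ⟨by lia, fun h => ?_⟩
      rw [h, h_one] at this
      exact Nat.not_lt_zero _ this
  rw [isInverseLimitSlender_iff]
  intro L _ K hK φ
  by_contra! hφ
  choose x hxK hx using fun n => SetLike.not_le_iff_exists.mp (hφ n)
  -- `ℓ (φ (x n)) + 1` squarings add at least that much length, and multiplication by `φ (x n)`
  -- removes at most `ℓ (φ (x n))`; so `φ (y n)` is strictly longer than `φ (y (n + 1))` when the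
  -- latter is nontrivial.
  obtain ⟨y, -, hy⟩ := hK.exists_eq_mul_pow x hxK fun n => 2 ^ (ℓ (φ (x n)) + 1)
  have hstep : ∀ n, φ (y n) = φ (x n) * φ (y (n + 1)) ^ 2 ^ (ℓ (φ (x n)) + 1) := by
    intro n
    rw [← map_pow, ← map_mul, ← hy n]
  have hlt : ∀ n, φ (y (n + 1)) ≠ 1 → ℓ (φ (y (n + 1))) < ℓ (φ (y n)) := by
    intro n hn
    have h1 := (h_pow _ hn (ℓ (φ (x n)) + 1)).1
    have h2 := h_mul (φ (x n))⁻¹ (φ (y n))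
    have h3 := h_inv (φ (x n))
    rw [inv_mul_eq_of_eq_mul (hstep n)] at h2
    lia
  have hne : ∀ n, φ (y n) ≠ 1 := by
    intro n hn
    by_cases h : φ (y (n + 1)) = 1
    · have := hstep n
      rw [h, one_pow, mul_one, hn] at this
      exact hx n this.symm
    · have := hlt n h
      rw [hn, h_one] at this
      exact Nat.not_lt_zero _ this
  have hanti : StrictAnti fun n => ℓ (φ (y n)) :=
    strictAnti_nat_of_succ_lt fun n => hlt n (hne (n + 1))
  exact not_strictAnti_of_wellFoundedLT _ hanti

/-! ### Squares and word length in a free product -/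

namespace Monoid.CoprodI

variable {ι : Type*} {G : ι → Type*} [∀ i, Group (G i)]

/-- A nonempty reduced list of letters whose product is not conjugate into a factor has a longer
reduced square, with the same first and last factors. -/
theorem exists_reduced_sq (l : List (Σ i, G i)) (hne : l ≠ []) (h1 : ∀ x ∈ l, x.2 ≠ 1)
    (hc : l.IsChain fun a b => a.1 ≠ b.1)
    (hconj : ∀ (g : CoprodI G) (i : ι) (h : G i),
      (l.map fun a => of a.2).prod ≠ g * of h * g⁻¹) :
    ∃ l' : List (Σ i, G i), (∀ x ∈ l', x.2 ≠ 1) ∧ (l'.IsChain fun a b => a.1 ≠ b.1) ∧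
      (l'.map fun a => of a.2).prod = (l.map fun a => of a.2).prod ^ 2 ∧
      l.length < l'.length ∧ l'.head?.map Sigma.fst = l.head?.map Sigma.fst ∧
      l'.getLast?.map Sigma.fst = l.getLast?.map Sigma.fst := by
  induction l using List.bidirectionalRec with
  | nil => exact absurd rfl hne
  | singleton a => exact absurd (by simp) (hconj 1 a.1 a.2)
  | cons_append a l b ih =>
    by_cases hab : a.1 = b.1
    · have hl : l ≠ [] := by
        rintro rfl
        simp [hab] at hc
      obtain ⟨i, x⟩ := a
      obtain ⟨j, y⟩ := b
      obtain rfl : i = j := hab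
      rw [List.isChain_cons, List.isChain_append] at hc
      obtain ⟨hx, hlc, -, hy⟩ := hc
      have hxl : ∀ c ∈ l.head?, i ≠ c.1 := fun c hcl => hx c (by
        rw [List.head?_append_of_ne_nil _ hl]
        exact hcl)
      have hyl : ∀ c ∈ l.getLast?, c.1 ≠ i := fun c hcl => hy c hcl ⟨i, y⟩ (by simp)
      have hx1 : x ≠ 1 := h1 ⟨i, x⟩ (by simp)
      have hy1 : y ≠ 1 := h1 ⟨i, y⟩ (by simp)
      have hl1 : ∀ c ∈ l, c.2 ≠ 1 := fun c hcl => h1 c (by simp [hcl])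
      -- The square is `x l (y x) l y`. If `y x = 1`, the word is a conjugate of `l`: square `l` by
      -- induction and wrap it again, which stays reduced because the end factors are preserved.
      -- Otherwise `y x` is a single letter and the displayed word is reduced.
      by_cases hyx : y * x = 1
      · obtain rfl : y = x⁻¹ := eq_inv_of_mul_eq_one_left hyx
        obtain ⟨l', h1', hc', hp', hlen, hhead, hlast⟩ := ih hl hl1 hlc fun g k h hg =>
          hconj (of x * g) k h (by simp [hg, mul_assoc])
        have hl' : l' ≠ [] := by
          rintro rfl
          simp at hlen
        refine ⟨⟨i, x⟩ :: (l' ++ [⟨i, x⁻¹⟩]), ?_, ?_, ?_, ?_, ?_, ?_⟩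
        · simp only [List.mem_cons, List.mem_append, List.not_mem_nil, or_false]
          rintro c (rfl | hcl | rfl)
          exacts [hx1, h1' c hcl, hy1]
        · rw [List.isChain_cons, List.isChain_append, List.head?_append_of_ne_nil _ hl']
          refine ⟨?_, hc', by simp, ?_⟩
          · intro c hcl
            have : l.head?.map Sigma.fst = some c.1 := by
              rw [← hhead, Option.mem_def.mp hcl]
              rfl
            obtain ⟨d, hd, hdc⟩ := Option.map_eq_some_iff.mp this
            exact hdc ▸ hxl d hd
          · intro c hcl e he
            have : l.getLast?.map Sigma.fst = some c.1 := by
              rw [← hlast, Option.mem_def.mp hcl]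
              rfl
            obtain ⟨d, hd, hdc⟩ := Option.map_eq_some_iff.mp this
            obtain rfl : (⟨i, x⁻¹⟩ : Σ i, G i) = e := by simpa using he
            exact hdc ▸ hyl d hd
        · simp [hp', pow_two, mul_assoc]
        · simpa using hlen
        · simp
        · simp [List.getLast?_cons, List.getLast?_append]
      · refine ⟨⟨i, x⟩ :: (l ++ (⟨i, y * x⟩ :: (l ++ [⟨i, y⟩]))), ?_, ?_, ?_, ?_, ?_, ?_⟩
        · simp only [List.mem_cons, List.mem_append, List.not_mem_nil, or_false]
          rintro c (rfl | hcl | rfl | hcl | rfl)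
          exacts [hx1, hl1 c hcl, hyx, hl1 c hcl, hy1]
        · simp only [List.isChain_cons, List.isChain_append, List.head?_append_of_ne_nil _ hl]
          refine ⟨hxl, hlc, ⟨hxl, hlc, by simp, ?_⟩, ?_⟩
          · intro c hcl e he
            obtain rfl : (⟨i, y⟩ : Σ i, G i) = e := by simpa using he
            exact hyl c hcl
          · intro c hcl e he
            obtain rfl : (⟨i, y * x⟩ : Σ i, G i) = e := by simpa using he
            exact hyl c hcl
        · simp [pow_two, mul_assoc]
        · simp
        · simp
        · simp [List.getLast?_cons, List.getLast?_append]
    · refine ⟨(a :: (l ++ [b])) ++ (a :: (l ++ [b])), ?_, ?_, ?_, ?_, ?_, ?_⟩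
      · intro c hcl
        exact h1 c ((List.mem_append.mp hcl).elim id id)
      · refine hc.append hc ?_
        intro c hcl d hdl
        obtain rfl : b = c := by simpa [List.getLast?_cons, List.getLast?_append] using hcl
        obtain rfl : a = d := by simpa using hdl
        exact Ne.symm hab
      · rw [List.map_append, List.prod_append, pow_two]
      · simp
      · simp
      · simp [List.getLast?_cons, List.getLast?_append]

open Classical in
/-- The number of letters of the reduced word representing an element of a free product. -/
noncomputable def wordLength (x : CoprodI G) : ℕ :=
  (Word.equiv x).toList.length

theorem wordLength_word_prod (w : Word G) : wordLength w.prod = w.toList.length := by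
  classical
  rw [wordLength]
  exact congrArg (fun w : Word G => w.toList.length) (Word.equiv.apply_symm_apply w)

theorem exists_word_prod_eq (x : CoprodI G) : ∃ w : Word G, w.prod = x := by
  classical
  exact ⟨Word.equiv x, Word.equiv.symm_apply_apply x⟩

/-- Split off the possibly trivial head in `G i`: the multiplication changes only that head, which
contributes at most one letter. -/
theorem wordLength_of_mul_le {i : ι} (g : G i) (x : CoprodI G) :
    wordLength (of g * x) ≤ wordLength x + 1 := by
  classical
  obtain ⟨w, rfl⟩ := exists_word_prod_eq x
  obtain ⟨p, rfl⟩ := (Word.equivPair i).symm.surjective w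
  have hle : p.tail.toList.length ≤ (Word.rcons p).toList.length := by
    rw [Word.rcons]
    split_ifs <;> simp
  have hge : ∀ q : Word.Pair G i, (Word.rcons q).toList.length ≤ q.tail.toList.length + 1 := by
    intro q
    rw [Word.rcons]
    split_ifs <;> simp
  have heq : of g * ((Word.equivPair i).symm p).prod =
      (Word.rcons ⟨g * p.head, p.tail, p.fstIdx_ne⟩).prod := by
    rw [Word.equivPair_symm, Word.prod_rcons, Word.prod_rcons, map_mul, mul_assoc]
  rw [heq, wordLength_word_prod, wordLength_word_prod, Word.equivPair_symm]
  exact (hge _).trans (Nat.succ_le_succ hle)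

@[simp]
theorem wordLength_one : wordLength (1 : CoprodI G) = 0 := by
  rw [← Word.prod_empty, wordLength_word_prod]
  rfl

theorem wordLength_list_prod_mul_le (l : List (Σ i, G i)) (x : CoprodI G) :
    wordLength ((l.map fun a => of a.2).prod * x) ≤ l.length + wordLength x := by
  induction l with
  | nil => simp
  | cons a l ih =>
    rw [List.map_cons, List.prod_cons, mul_assoc, List.length_cons]
    exact (wordLength_of_mul_le _ _).trans (by lia)

theorem wordLength_mul_le (x y : CoprodI G) :
    wordLength (x * y) ≤ wordLength x + wordLength y := by
  obtain ⟨w, rfl⟩ := exists_word_prod_eq x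
  rw [wordLength_word_prod]
  exact wordLength_list_prod_mul_le _ _

theorem wordLength_inv_le (x : CoprodI G) : wordLength x⁻¹ ≤ wordLength x := by
  obtain ⟨w, rfl⟩ := exists_word_prod_eq x
  rw [wordLength_word_prod]
  have h : ∀ l : List (Σ i, G i), wordLength (l.map fun a => of a.2).prod⁻¹ ≤ l.length := by
    intro l
    induction l with
    | nil => simp
    | cons a l ih =>
      rw [List.map_cons, List.prod_cons, mul_inv_rev, List.length_cons, ← map_inv]
      refine (wordLength_mul_le _ _).trans (Nat.add_le_add ih ?_)
      simpa using wordLength_of_mul_le a.2⁻¹ (1 : CoprodI G)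
  exact h w.toList

/-- Squaring increases the word length of an element not conjugate into a factor. -/
theorem wordLength_lt_wordLength_sq {x : CoprodI G} (hx : x ≠ 1)
    (hconj : ∀ (g : CoprodI G) (i : ι) (h : G i), x ≠ g * of h * g⁻¹) :
    wordLength x < wordLength (x ^ 2) := by
  obtain ⟨w, rfl⟩ := exists_word_prod_eq x
  have hw : w.toList ≠ [] := fun h => hx (by rw [Word.prod, h, List.map_nil, List.prod_nil])
  obtain ⟨l', h1, hc, hp, hlen, -⟩ := exists_reduced_sq w.toList hw w.ne_one w.chain_ne hconj
  have : wordLength (w.prod ^ 2) = l'.length :=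
    (congrArg wordLength hp.symm).trans (wordLength_word_prod ⟨l', h1, hc⟩)
  rw [this, wordLength_word_prod]
  exact hlen

end Monoid.CoprodI

/-! ### The map to the direct sum, and free products -/

open Classical in
/-- The canonical homomorphism from the free product to the product. -/
noncomputable def coprodToPi {ι : Type*} (G : ι → Type*) [∀ i, Group (G i)] :
    Monoid.CoprodI G →* ∀ i, G i :=
  Monoid.CoprodI.lift fun i => MonoidHom.mulSingle G i

theorem coprodToPi_mem_groupDirectSum {ι : Type*} {G : ι → Type*} [∀ i, Group (G i)]
    (x : Monoid.CoprodI G) : coprodToPi G x ∈ groupDirectSum G := by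
  classical
  refine Monoid.CoprodI.lift_range_le G _ ?_ ⟨x, rfl⟩
  rintro i _ ⟨g, rfl⟩
  refine (Set.finite_singleton i).subset fun j hj => ?_
  by_contra h
  exact hj (Pi.mulSingle_eq_of_ne h g)

/-- The map is injective on each factor, so its kernel meets conjugates of factors trivially. -/
theorem coprodToPi_conj_of_eq_one {ι : Type*} {G : ι → Type*} [∀ i, Group (G i)]
    {g : Monoid.CoprodI G} {i : ι} {h : G i}
    (hg : coprodToPi G (g * Monoid.CoprodI.of h * g⁻¹) = 1) : h = 1 := by
  classical
  rw [map_mul, map_mul, map_inv, conj_eq_one_iff, coprodToPi, Monoid.CoprodI.lift_of] at hg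
  have := congrFun hg i
  simpa using this

theorem IsInverseLimitSlender.coprodI {ι : Type*} {G : ι → Type*} [∀ i, Group (G i)]
    (hG : ∀ i, IsInverseLimitSlender.{v} (G i)) :
    IsInverseLimitSlender.{v} (Monoid.CoprodI G) := by
  refine (IsInverseLimitSlender.groupDirectSum hG).of_ker
    ((coprodToPi G).codRestrict _ coprodToPi_mem_groupDirectSum) ?_
  refine isInverseLimitSlender_of_length (fun x => Monoid.CoprodI.wordLength x.1)
    Monoid.CoprodI.wordLength_one (fun a b => Monoid.CoprodI.wordLength_mul_le a.1 b.1)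
    (fun a => Monoid.CoprodI.wordLength_inv_le a.1) ?_
  rintro ⟨a, ha⟩ ha1
  refine Monoid.CoprodI.wordLength_lt_wordLength_sq (fun h => ha1 (Subtype.ext h)) ?_
  rintro g i h rfl
  have := coprodToPi_conj_of_eq_one (congrArg Subtype.val ha)
  exact ha1 (Subtype.ext (by simp [this]))

theorem theorem3p6 :
    -- subgroups
    (∀ (G : Type*) [Group G] (K : Subgroup G),
      IsInverseLimitSlender.{v} G → IsInverseLimitSlender.{v} K) ∧
    -- extensions `1 → A → E → Q → 1`
    (∀ (A : Type*) (E : Type*) (Q : Type*) [Group A] [Group E] [Group Q],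
      GroupExtension A E Q → IsInverseLimitSlender.{v} A → IsInverseLimitSlender.{v} Q →
        IsInverseLimitSlender.{v} E) ∧
    -- arbitrary direct sums
    (∀ (ι : Type*) (G : ι → Type*) [∀ i, Group (G i)],
      (∀ i, IsInverseLimitSlender.{v} (G i)) →
        IsInverseLimitSlender.{v} (groupDirectSum G)) ∧
    -- arbitrary free products
    (∀ (ι : Type*) (G : ι → Type*) [∀ i, Group (G i)],
      (∀ i, IsInverseLimitSlender.{v} (G i)) →
        IsInverseLimitSlender.{v} (Monoid.CoprodI G)) :=
  ⟨fun _ _ K hG => hG.of_injective K.subtype K.subtype_injective,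
    fun _ _ _ _ _ _ S hA hQ => .of_groupExtension S hA hQ,
    fun _ _ _ hG => .groupDirectSum hG,
    fun _ _ _ hG => .coprodI hG⟩
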